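/- Formulas are generated from a set of propositional variables $a$ and the constants $1,\bot,\circ$ by $A,B ::= a \mid a^\perp \mid A⅋B \mid A\otimes B \mid\ !A \mid\ ?A \mid \bot \mid 1 \mid \circ$, where $\circ$ is a placeholder for $\bot$ and for weakened formulas; a $\mathsf{MELL}$-formula is a formula without occurrences of $\circ$. Sequents are non-empty finite multisets of formulas, and $?\Gamma$ is obtained from $\Gamma$ by prefixing every formula with $?$. A formula $F$ is provable in a sequent system if the sequent consisting of $F$ alone is derivable. $\mathsf{MELL}$ is the cut-free sequent calculus with the axioms $\vdash a,a^\perp$ and $\vdash 1$ and the rules: $⅋$ (from $\Gamma,A,B$ infer $\Gamma,A⅋B$); $\otimes$ (from $\Gamma,A$ and $B,\Delta$ infer $\Gamma,A\otimes B,\Delta$); $\bot$ (from $\Gamma$ infer $\Gamma,\bot$); promotion (from $A,?\Gamma$ infer $!A,?\Gamma$); dereliction (from $\Gamma,A$ infer $\Gamma,?A$); weakening (from $\Gamma$ infer $\Gamma,?A$); contraction (from $\Gamma,?A,?A$ infer $\Gamma,?A$). $\mathsf{MELL}^\ell$ is the sequent calculus with the axioms $\mathsf{ax}_j$: $\vdash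 a,a^\perp,\circ,\dots,\circ$ and $1_j$: $\vdash 1,\circ,\dots,\circ$ (any finite number, possibly zero, of $\circ$), the above rules $⅋$ and $\otimes$, and weak promotion (from $A,\Gamma$ infer $!A,?\Gamma$). $\partial\mathsf{MELL}$ consists of the following rewriting rules, read from premise to conclusion and applicable inside an arbitrary formula context $C\{\ \}$ (a formula with one hole): dereliction $C\{A\}\to C\{?A\}$; digging $C\{??A\}\to C\{?A\}$; $\circ$-digging $C\{?\circ\}\to C\{\circ\}$; $\bot^j$: $C\{\circ\}\to C\{\bot\}$; $w^j$: $C\{\circ\}\to C\{?A\}$; contraction $C\{?A⅋?A\}\to C\{?A\}$. For a subset $S$ of these rules, $F'$ derives $F$ in $S$ if $F$ is obtained from $F'$ by finitely many (possibly zero) applications of rules of $S$. Theorem. (i) A $\mathsf{MELL}$-formula $F$ is provable in $\mathsf{MELL}$ if and only if there is a formula $F'$ that is provable in $\mathsf{MELL}^\ell$ and derives $F$ in $\partial\mathsf{MELL}$. (ii) If a formula $F$ is provable in $\mathsf{MELL}$, then there are formulas $F',F'',F'''$ such that $F'$ is provable in $\mathsf{MELL}^\ell$, $F'$ derives $F''$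 using only dereliction, digging and $\circ$-digging, $F''$ derives $F'''$ using only $w^j$ and $\bot^j$, and $F'''$ derives $F$ using only contraction. -/

import Mathlib

namespace MELL

/-- Formulas in negation normal form over propositional variables in `α`.
`jump` is the placeholder constant `∘`. -/
inductive Formula (α : Type*) where
  | pos (a : α)
  | neg (a : α)
  | par (A B : Formula α)
  | tens (A B : Formula α)
  | ofCourse (A : Formula α)
  | whyNot (A : Formula α)
  | bot
  | one
  | jump

/-- A `MELL`-formula is a formula without occurrences of `∘`. -/
def Formula.IsMELL {α : Type*} : Formula α → Prop
  | .pos _ => True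
  | .neg _ => True
  | .par A B => A.IsMELL ∧ B.IsMELL
  | .tens A B => A.IsMELL ∧ B.IsMELL
  | .ofCourse A => A.IsMELL
  | .whyNot A => A.IsMELL
  | .bot => True
  | .one => True
  | .jump => False

/-- Sequents are multisets of formulas. Both calculi below derive only non-empty ones, since
every rule has a non-empty conclusion. -/
abbrev Sequent (α : Type*) := Multiset (Formula α)

/-- `?Γ` -/
def whyNots {α : Type*} (Γ : Sequent α) : Sequent α := Γ.map Formula.whyNot

/-- Derivability in the cut-free sequent calculus
`MELL = {ax, ⅋, ⊗, ⊥, 1, !p, der, w, c}`. -/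
inductive Derivable {α : Type*} : Sequent α → Prop
  | ax (a : α) : Derivable {.pos a, .neg a}
  | par (Γ : Sequent α) (A B : Formula α) :
      Derivable (A ::ₘ B ::ₘ Γ) → Derivable (.par A B ::ₘ Γ)
  | tens (Γ Δ : Sequent α) (A B : Formula α) :
      Derivable (A ::ₘ Γ) → Derivable (B ::ₘ Δ) → Derivable (.tens A B ::ₘ (Γ + Δ))
  | bot (Γ : Sequent α) : Derivable Γ → Derivable (.bot ::ₘ Γ)
  | one : Derivable {.one}
  | prom (Γ : Sequent α) (A : Formula α) :
      Derivable (A ::ₘ whyNots Γ) → Derivable (.ofCourse A ::ₘ whyNots Γ)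
  | der (Γ : Sequent α) (A : Formula α) :
      Derivable (A ::ₘ Γ) → Derivable (.whyNot A ::ₘ Γ)
  | weak (Γ : Sequent α) (A : Formula α) :
      Derivable Γ → Derivable (.whyNot A ::ₘ Γ)
  | contr (Γ : Sequent α) (A : Formula α) :
      Derivable (.whyNot A ::ₘ .whyNot A ::ₘ Γ) → Derivable (.whyNot A ::ₘ Γ)

/-- Derivability in the linear sequent calculus `MELLˡ = {ax_j, 1_j, ⅋, ⊗, w!p}`, where the
initial sequents may carry any finite number of placeholders and `w!p` is weak promotion. -/
inductive LinDerivable {α : Type*} : Sequent α → Prop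
  | axJ (n : ℕ) (a : α) :
      LinDerivable (.pos a ::ₘ .neg a ::ₘ Multiset.replicate n .jump)
  | oneJ (n : ℕ) : LinDerivable (.one ::ₘ Multiset.replicate n .jump)
  | par (Γ : Sequent α) (A B : Formula α) :
      LinDerivable (A ::ₘ B ::ₘ Γ) → LinDerivable (.par A B ::ₘ Γ)
  | tens (Γ Δ : Sequent α) (A B : Formula α) :
      LinDerivable (A ::ₘ Γ) → LinDerivable (B ::ₘ Δ) →
        LinDerivable (.tens A B ::ₘ (Γ + Δ))
  | weakProm (Γ : Sequent α) (A : Formula α) :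
      LinDerivable (A ::ₘ Γ) → LinDerivable (.ofCourse A ::ₘ whyNots Γ)

/-- A formula is provable if the one-formula sequent is derivable. -/
def Provable {α : Type*} (F : Formula α) : Prop := Derivable {F}

/-- Provability of a formula in `MELLˡ`. -/
def LinProvable {α : Type*} (F : Formula α) : Prop := LinDerivable {F}

/-- Formulas with exactly one hole. -/
inductive Context (α : Type*) where
  | hole
  | parL (C : Context α) (B : Formula α)
  | parR (A : Formula α) (C : Context α)
  | tensL (C : Context α) (B : Formula α)
  | tensR (A : Formula α) (C : Context α)
  | ofCourse (C : Context α)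
  | whyNot (C : Context α)

/-- `C.plug A` fills the hole of `C` with `A`. -/
def Context.plug {α : Type*} : Context α → Formula α → Formula α
  | .hole, X => X
  | .parL C B, X => .par (C.plug X) B
  | .parR A C, X => .par A (C.plug X)
  | .tensL C B, X => .tens (C.plug X) B
  | .tensR A C, X => .tens A (C.plug X)
  | .ofCourse C, X => .ofCourse (C.plug X)
  | .whyNot C, X => .whyNot (C.plug X)

/-- The names of the deep inference rules. -/
inductive DeepRule where
  | der
  | dig
  | digJump
  | bot
  | weak
  | contr

/-- `Redex ρ X Y`: the rule `ρ`, in the empty context, has premise `X` and conclusion `Y`. -/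
inductive Redex {α : Type*} : DeepRule → Formula α → Formula α → Prop
  | der (A : Formula α) : Redex .der A (.whyNot A)
  | dig (A : Formula α) : Redex .dig (.whyNot (.whyNot A)) (.whyNot A)
  | digJump : Redex .digJump (.whyNot .jump) .jump
  | bot : Redex .bot .jump .bot
  | weak (A : Formula α) : Redex .weak .jump (.whyNot A)
  | contr (A : Formula α) : Redex .contr (.par (.whyNot A) (.whyNot A)) (.whyNot A)

/-- `F` is the premise and `G` the conclusion of one rule of `S`, applied in some context. -/
def DeepStep {α : Type*} (S : Set DeepRule) (F G : Formula α) : Prop :=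
  ∃ ρ ∈ S, ∃ (C : Context α) (X Y : Formula α),
    Redex ρ X Y ∧ F = C.plug X ∧ G = C.plug Y

/-- `G` is derived from `F` by finitely many (possibly no) applications of deep rules of `S`. -/
def DeepDerives {α : Type*} (S : Set DeepRule) : Formula α → Formula α → Prop :=
  Relation.ReflTransGen (DeepStep S)

/-- The deep system `∂MELL`. -/
def deepMELL : Set DeepRule := {.der, .dig, .digJump, .bot, .weak, .contr}

end MELL

/-! Soundness, the "if" of (i), needs no cut elimination. In the phase space of sequents whose pole
is the set of cut-free derivable ones, `MELLˡ` is sound (`LinDerivable.sound`) and each deep rule is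
an inclusion of facts, stable under contexts (`DeepDerives.interp_subset`). So the empty sequent,
which lies in the fact of `F'`, lies in that of `F`, and `interp_subset_orth_singleton` turns this
into a cut-free derivation of `F`.

The decomposition (ii), which gives the "only if", is an induction on derivations with a looser
invariant: a formula `?A` of a derivable sequent is represented by a non-empty multiset of formulas
(`Unfolds`). Contraction merges two multisets, and deep contractions are made only when a rule needs
one formula (`Unfolds.collapse`). Since every representative carries its deep derivation already
sorted by stage, no rules are ever permuted. -/

namespace MELL

variable {α : Type*}

/-! ### Phase semantics over cut-free derivability -/

/-- The orthogonal of a set of sequents with respect to cut-free derivability. -/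
def orth (S : Set (Sequent α)) : Set (Sequent α) := {Γ | ∀ Δ ∈ S, Derivable (Γ + Δ)}

theorem subset_orth_orth (S : Set (Sequent α)) : S ⊆ orth (orth S) := fun Γ hΓ Δ hΔ => by
  rw [add_comm]; exact hΔ Γ hΓ

theorem orth_anti {S T : Set (Sequent α)} (h : S ⊆ T) : orth T ⊆ orth S :=
  fun _ hΓ Δ hΔ => hΓ Δ (h hΔ)

theorem orth_orth_orth (S : Set (Sequent α)) : orth (orth (orth S)) = orth S :=
  (orth_anti (subset_orth_orth S)).antisymm (subset_orth_orth _)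

/-- The facts interpreting formulas in the phase space of sequents. -/
def interp : Formula α → Set (Sequent α)
  | .pos a => orth {{.pos a}}
  | .neg a => orth (orth {{.pos a}})
  | .par A B => orth (Set.image2 (· + ·) (orth (interp A)) (orth (interp B)))
  | .tens A B => orth (orth (Set.image2 (· + ·) (interp A) (interp B)))
  | .ofCourse A => orth (orth (interp A ∩ Set.range whyNots))
  | .whyNot A => orth (orth (interp A) ∩ Set.range whyNots)
  | .bot => orth {0}
  | .one => orth (orth {0})
  | .jump => orth {0}

theorem orth_orth_interp (A : Formula α) : orth (orth (interp A)) = interp A := by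
  cases A <;> exact orth_orth_orth _

theorem mem_orth_zero {Γ : Sequent α} : Γ ∈ orth {0} ↔ Derivable Γ := by
  simp [orth]

theorem mem_orth_singleton {Γ : Sequent α} {A : Formula α} :
    Γ ∈ orth {{A}} ↔ Derivable (A ::ₘ Γ) := by
  simp [orth, add_comm Γ, Multiset.singleton_add]

theorem orth_orth_subset_orth_singleton {S : Set (Sequent α)} {A : Formula α}
    (h : ∀ Γ ∈ S, Derivable (A ::ₘ Γ)) : orth (orth S) ⊆ orth {{A}} :=
  orth_anti (Set.singleton_subset_iff.2 fun Γ hΓ => by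
    rw [Multiset.singleton_add]; exact h Γ hΓ)

theorem singleton_mem_orth {S : Set (Sequent α)} {A : Formula α} (h : S ⊆ orth {{A}}) :
    {A} ∈ orth S := fun Γ hΓ => by
  rw [Multiset.singleton_add]; exact mem_orth_singleton.1 (h hΓ)

/-- A `MELL`-formula can be derived next to every element of its interpretation. -/
theorem interp_subset_orth_singleton (A : Formula α) (hA : A.IsMELL) :
    interp A ⊆ orth {{A}} := by
  induction A with
  | pos a => exact subset_rfl
  | neg a =>
    refine orth_anti (Set.singleton_subset_iff.2 (mem_orth_singleton.2 ?_))
    exact Derivable.ax a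
  | par A B ihA ihB =>
    intro Γ hΓ
    have h := hΓ _ (Set.mem_image2_of_mem (singleton_mem_orth (ihA hA.1))
      (singleton_mem_orth (ihB hA.2)))
    rw [add_comm, add_assoc, Multiset.singleton_add, Multiset.singleton_add] at h
    exact mem_orth_singleton.2 (.par _ _ _ h)
  | tens A B ihA ihB =>
    refine orth_orth_subset_orth_singleton ?_
    rintro _ ⟨Γ, hΓ, Δ, hΔ, rfl⟩
    exact .tens _ _ _ _ (mem_orth_singleton.1 (ihA hA.1 hΓ)) (mem_orth_singleton.1 (ihB hA.2 hΔ))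
  | ofCourse A ih =>
    refine orth_orth_subset_orth_singleton ?_
    rintro _ ⟨hΓ, Γ, rfl⟩
    exact .prom _ _ (mem_orth_singleton.1 (ih hA hΓ))
  | whyNot A ih =>
    -- The sequent `{?A}` is itself of the form `?Γ`, with `Γ = {A}`; dereliction puts it in `orth
    -- (interp A)`.
    refine orth_anti (Set.singleton_subset_iff.2 ⟨?_, {A}, by simp [whyNots]⟩)
    exact singleton_mem_orth fun Γ hΓ =>
      mem_orth_singleton.2 (.der _ _ (mem_orth_singleton.1 (ih hA hΓ)))
  | bot => exact fun Γ hΓ => mem_orth_singleton.2 (.bot _ (mem_orth_zero.1 hΓ))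
  | one => exact orth_anti (Set.singleton_subset_iff.2 (mem_orth_zero.2 .one))
  | jump => exact hA.elim

/-! ### Deep rules as inclusions of facts -/

theorem interp_plug_mono (C : Context α) {X Y : Formula α} (h : interp X ⊆ interp Y) :
    interp (C.plug X) ⊆ interp (C.plug Y) := by
  induction C with
  | hole => exact h
  | parL C B ih => exact orth_anti (Set.image2_subset (orth_anti ih) subset_rfl)
  | parR A C ih => exact orth_anti (Set.image2_subset subset_rfl (orth_anti ih))
  | tensL C B ih => exact orth_anti (orth_anti (Set.image2_subset ih subset_rfl))
  | tensR A C ih => exact orth_anti (orth_anti (Set.image2_subset subset_rfl ih))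
  | ofCourse C ih => exact orth_anti (orth_anti (Set.inter_subset_inter_left _ ih))
  | whyNot C ih => exact orth_anti (Set.inter_subset_inter_left _ (orth_anti ih))

theorem Derivable.add_whyNots {Γ : Sequent α} (h : Derivable Γ) (Δ : Sequent α) :
    Derivable (Γ + whyNots Δ) := by
  induction Δ using Multiset.induction with
  | empty => simpa [whyNots] using h
  | cons A Δ ih =>
    simpa [whyNots] using Derivable.weak _ A ih

theorem Derivable.contract_whyNots {Γ : Sequent α} (Δ : Sequent α)
    (h : Derivable (Γ + (whyNots Δ + whyNots Δ))) : Derivable (Γ + whyNots Δ) := by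
  induction Δ using Multiset.induction generalizing Γ with
  | empty => simpa [whyNots] using h
  | cons A Δ ih =>
    have h' : Derivable (A.whyNot ::ₘ A.whyNot ::ₘ (Γ + (whyNots Δ + whyNots Δ))) := by
      simpa [whyNots] using h
    have := @ih (A.whyNot ::ₘ Γ) (by simpa using h'.contr)
    simpa [whyNots] using this

theorem inter_subset_orth_interp_whyNot (A : Formula α) :
    orth (interp A) ∩ Set.range whyNots ⊆ orth (interp A.whyNot) := subset_orth_orth _

/-- The fact of `?A` is tested only against sequents `?Δ`, and these can be weakened in and
contracted. -/
theorem Redex.interp_subset {ρ : DeepRule} {X Y : Formula α} (h : Redex ρ X Y) :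
    interp X ⊆ interp Y := by
  cases h with
  | der =>
    rw [← orth_orth_interp X]
    exact orth_anti Set.inter_subset_left
  | dig A =>
    exact orth_anti fun Γ hΓ => ⟨inter_subset_orth_interp_whyNot A hΓ, hΓ.2⟩
  | digJump =>
    -- The empty sequent is `?∅`, so the restriction to `?`-sequents does not exclude it.
    exact orth_anti (Set.singleton_subset_iff.2
      ⟨subset_orth_orth _ rfl, 0, by simp [whyNots]⟩)
  | bot => exact subset_rfl
  | weak A =>
    rintro Γ hΓ _ ⟨-, Δ, rfl⟩
    exact (mem_orth_zero.1 hΓ).add_whyNots Δ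
  | contr A =>
    rintro Γ hΓ Δ hΔ
    have hΔ' := inter_subset_orth_interp_whyNot A hΔ
    -- The same test `Δ` serves both copies of `?A`, leaving `Γ + (Δ + Δ)` to contract.
    have h := hΓ _ (Set.mem_image2_of_mem hΔ' hΔ')
    obtain ⟨-, Δ, rfl⟩ := hΔ
    exact h.contract_whyNots

theorem DeepDerives.interp_subset {S : Set DeepRule} {F G : Formula α} (h : DeepDerives S F G) :
    interp F ⊆ interp G := by
  induction h with
  | refl => exact subset_rfl
  | tail _ h ih =>
    obtain ⟨ρ, -, C, X, Y, hr, rfl, rfl⟩ := h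
    exact ih.trans (interp_plug_mono C hr.interp_subset)

/-- Choosing in each of several double orthogonals amounts to choosing in the given sets. -/
theorem derivable_add_sum_of_rel_orth_orth (S : Formula α → Set (Sequent α)) (Γ : Sequent α)
    (L : Multiset (Sequent α)) (Δ : Sequent α)
    (hL : Multiset.Rel (fun x A => x ∈ orth (orth (S A))) L Γ)
    (h : ∀ L', Multiset.Rel (fun x A => x ∈ S A) L' Γ → Derivable (Δ + L'.sum)) :
    Derivable (Δ + L.sum) := by
  induction hL generalizing Δ with
  | zero => exact h 0 .zero
  | @cons x A L Γ hx _ ih =>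
    rw [Multiset.sum_cons, add_left_comm]
    refine hx _ fun y hy => ?_
    rw [add_comm, ← add_assoc]
    refine ih _ fun L' hL' => ?_
    have := h (y ::ₘ L') (.cons hy hL')
    rwa [Multiset.sum_cons, add_left_comm, ← add_assoc] at this

/-- Elements of `orth (interp .jump)` are by definition those that can be added to any derivable
sequent; this handles the extra placeholders of the axioms. -/
theorem derivable_add_sum_of_rel_jump {n : ℕ} {L : Multiset (Sequent α)} {Δ : Sequent α}
    (hL : Multiset.Rel (fun x A => x ∈ orth (interp A)) L
      (Multiset.replicate n (Formula.jump : Formula α)))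
    (h : Derivable Δ) : Derivable (Δ + L.sum) := by
  induction n generalizing L Δ with
  | zero =>
    rw [Multiset.replicate_zero, Multiset.rel_zero_right] at hL
    simpa [hL] using h
  | succ n ih =>
    rw [Multiset.replicate_succ, Multiset.rel_cons_right] at hL
    obtain ⟨x, L, hx, hL, rfl⟩ := hL
    rw [Multiset.sum_cons, ← add_assoc]
    refine ih hL ?_
    rw [add_comm]
    exact hx _ (mem_orth_zero.2 h)

theorem sum_mem_range_whyNots {L : Multiset (Sequent α)} {Γ : Sequent α}
    (hL : Multiset.Rel (fun x _ => x ∈ Set.range whyNots) L Γ) :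
    L.sum ∈ Set.range (whyNots (α := α)) := by
  induction hL with
  | zero => exact ⟨0, rfl⟩
  | cons hx _ ih =>
    obtain ⟨Δ, rfl⟩ := hx
    obtain ⟨Θ, hΘ⟩ := ih
    exact ⟨Δ + Θ, by simp [← hΘ, whyNots]⟩

/-- Soundness of `MELLˡ` in the phase space of sequents. -/
theorem LinDerivable.sound {Γ : Sequent α} (h : LinDerivable Γ) (L : Multiset (Sequent α))
    (hL : Multiset.Rel (fun x A => x ∈ orth (interp A)) L Γ) : Derivable L.sum := by
  induction h generalizing L with
  | axJ n a =>
    rw [Multiset.rel_cons_right] at hL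
    obtain ⟨x, _, hx, hL, rfl⟩ := hL
    rw [Multiset.rel_cons_right] at hL
    obtain ⟨y, L, hy, hL, rfl⟩ := hL
    rw [Multiset.sum_cons, Multiset.sum_cons, ← add_assoc, add_comm x]
    exact derivable_add_sum_of_rel_jump hL (hy x hx)
  | oneJ n =>
    rw [Multiset.rel_cons_right] at hL
    obtain ⟨x, L, hx, hL, rfl⟩ := hL
    rw [Multiset.sum_cons]
    refine derivable_add_sum_of_rel_jump hL (mem_orth_zero.1 ?_)
    rwa [interp, orth_orth_orth] at hx
  | par Γ A B _ ih =>
    rw [Multiset.rel_cons_right] at hL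
    obtain ⟨x, L, hx, hL, rfl⟩ := hL
    rw [Multiset.sum_cons]
    refine hx _ ?_
    rintro _ ⟨y, hy, z, hz, rfl⟩
    have := ih (y ::ₘ z ::ₘ L) (.cons hy (.cons hz hL))
    rwa [Multiset.sum_cons, Multiset.sum_cons, ← add_assoc, add_comm] at this
  | tens Γ Δ A B _ _ ihA ihB =>
    rw [Multiset.rel_cons_right] at hL
    obtain ⟨x, _, hx, hL, rfl⟩ := hL
    rw [Multiset.rel_add_right] at hL
    obtain ⟨L₁, L₂, h₁, h₂, rfl⟩ := hL
    rw [interp, orth_orth_orth] at hx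
    rw [Multiset.sum_cons, Multiset.sum_add]
    refine hx _ (Set.mem_image2_of_mem ?_ ?_)
    · rw [← orth_orth_interp A]
      intro y hy
      simpa [add_comm] using ihA (y ::ₘ L₁) (.cons hy h₁)
    · rw [← orth_orth_interp B]
      intro y hy
      simpa [add_comm] using ihB (y ::ₘ L₂) (.cons hy h₂)
  | weakProm Γ A _ ih =>
    rw [Multiset.rel_cons_right] at hL
    obtain ⟨x, L, hx, hL, rfl⟩ := hL
    rw [interp, orth_orth_orth] at hx
    rw [Multiset.sum_cons]
    rw [whyNots, Multiset.rel_map_right] at hL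
    -- The sequents chosen for the formulas `?B` may be assumed to be `?`-sequents orthogonal to
    -- `interp B`; their sum is then a `?`-sequent, as the clause for `!A` demands.
    refine derivable_add_sum_of_rel_orth_orth
      (fun B => orth (interp B) ∩ Set.range whyNots) Γ L x hL ?_
    intro L' hL'
    refine hx _ ⟨?_, ?_⟩
    · rw [← orth_orth_interp A]
      intro y hy
      simpa [add_comm] using
        ih (y ::ₘ L') (.cons hy (hL'.mono fun _ _ _ _ hr => hr.1))
    · exact sum_mem_range_whyNots (hL'.mono fun _ _ _ _ hr => hr.2)

theorem provable_of_linProvable_of_deepDerives {F F' : Formula α} {S : Set DeepRule}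
    (hF : F.IsMELL) (h' : LinProvable F') (h : DeepDerives S F' F) : Provable F := by
  have h0 : (0 : Sequent α) ∈ interp F' := by
    rw [← orth_orth_interp]
    intro x hx
    simpa using LinDerivable.sound h' {x} (.cons hx .zero)
  exact mem_orth_singleton.1 (interp_subset_orth_singleton F hF (h.interp_subset h0))

/-! ### Decomposition of derivations -/

theorem DeepDerives.mono {S T : Set DeepRule} (hST : S ⊆ T) {F G : Formula α}
    (h : DeepDerives S F G) : DeepDerives T F G :=
  Relation.ReflTransGen.mono (fun _ _ ⟨ρ, hρ, hr⟩ => ⟨ρ, hST hρ, hr⟩) _ _ h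

/-- Composition of contexts. -/
def Context.comp : Context α → Context α → Context α
  | .hole, D => D
  | .parL C B, D => .parL (C.comp D) B
  | .parR A C, D => .parR A (C.comp D)
  | .tensL C B, D => .tensL (C.comp D) B
  | .tensR A C, D => .tensR A (C.comp D)
  | .ofCourse C, D => .ofCourse (C.comp D)
  | .whyNot C, D => .whyNot (C.comp D)

theorem Context.plug_comp (C D : Context α) (X : Formula α) :
    (C.comp D).plug X = C.plug (D.plug X) := by
  induction C <;> simp [Context.comp, Context.plug, *]

theorem DeepDerives.plug {S : Set DeepRule} {F G : Formula α} (C : Context α)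
    (h : DeepDerives S F G) : DeepDerives S (C.plug F) (C.plug G) :=
  Relation.ReflTransGen.lift C.plug (fun _ _ ⟨ρ, hρ, D, X, Y, hr, hF, hG⟩ =>
    ⟨ρ, hρ, C.comp D, X, Y, hr, by rw [hF, Context.plug_comp], by rw [hG, Context.plug_comp]⟩) _ _ h

theorem DeepDerives.par {S : Set DeepRule} {F F' G G' : Formula α}
    (h : DeepDerives S F F') (h' : DeepDerives S G G') :
    DeepDerives S (.par F G) (.par F' G') :=
  (h.plug (.parL .hole G)).trans (h'.plug (.parR F' .hole))

theorem DeepDerives.tens {S : Set DeepRule} {F F' G G' : Formula α}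
    (h : DeepDerives S F F') (h' : DeepDerives S G G') :
    DeepDerives S (.tens F G) (.tens F' G') :=
  (h.plug (.tensL .hole G)).trans (h'.plug (.tensR F' .hole))

theorem Redex.deepDerives {S : Set DeepRule} {ρ : DeepRule} {X Y : Formula α}
    (h : Redex ρ X Y) (hρ : ρ ∈ S) : DeepDerives S X Y :=
  .single ⟨ρ, hρ, .hole, X, Y, h, rfl, rfl⟩

/-- The rules dereliction, digging and `∘`-digging. -/
def digRules : Set DeepRule := {DeepRule.der, DeepRule.dig, DeepRule.digJump}

/-- The rules replacing placeholders. -/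
def weakRules : Set DeepRule := {DeepRule.weak, DeepRule.bot}

/-- Placeholder replacement followed by contraction. -/
def WeakContr (X A : Formula α) : Prop :=
  ∃ Y, DeepDerives weakRules X Y ∧ DeepDerives {DeepRule.contr} Y A

/-- A deep derivation made of digging, placeholder replacement and contraction, in this order. -/
def Staged (X A : Formula α) : Prop := ∃ Y, DeepDerives digRules X Y ∧ WeakContr Y A

theorem Staged.refl (A : Formula α) : Staged A A := ⟨A, .refl, A, .refl, .refl⟩

theorem Staged.par {X A Y B : Formula α} :
    Staged X A → Staged Y B → Staged (.par X Y) (.par A B) :=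
  fun ⟨_, h₁, _, h₂, h₃⟩ ⟨_, k₁, _, k₂, k₃⟩ => ⟨_, h₁.par k₁, _, h₂.par k₂, h₃.par k₃⟩

theorem Staged.tens {X A Y B : Formula α} :
    Staged X A → Staged Y B → Staged (.tens X Y) (.tens A B) :=
  fun ⟨_, h₁, _, h₂, h₃⟩ ⟨_, k₁, _, k₂, k₃⟩ => ⟨_, h₁.tens k₁, _, h₂.tens k₂, h₃.tens k₃⟩

theorem WeakContr.plug {X A : Formula α} (C : Context α) :
    WeakContr X A → WeakContr (C.plug X) (C.plug A) :=
  fun ⟨_, h₂, h₃⟩ => ⟨_, h₂.plug C, h₃.plug C⟩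

theorem Staged.plug {X A : Formula α} (C : Context α) :
    Staged X A → Staged (C.plug X) (C.plug A) :=
  fun ⟨_, h₁, h⟩ => ⟨_, h₁.plug C, h.plug C⟩

/-- Contraction is the last stage, so one more can be appended. -/
theorem Staged.contract {X Y A : Formula α} (hX : Staged X (.whyNot A))
    (hY : Staged Y (.whyNot A)) : Staged (.par X Y) (.whyNot A) := by
  obtain ⟨_, h₁, _, h₂, h₃⟩ := hX.par hY
  exact ⟨_, h₁, _, h₂, h₃.trans ((Redex.contr A).deepDerives rfl)⟩

/-- `X` yields `?A` in stages, and is a placeholder or a `?`-formula after the first stage. -/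
def StagedWhyNot (X A : Formula α) : Prop :=
  DeepDerives digRules X .jump ∨ ∃ Y, DeepDerives digRules X (.whyNot Y) ∧ WeakContr Y A

theorem StagedWhyNot.staged {X A : Formula α} : StagedWhyNot X A → Staged X (.whyNot A)
  | .inl h => ⟨_, h, _, (Redex.weak A).deepDerives (by simp [weakRules]), .refl⟩
  | .inr ⟨_, h₁, h₂⟩ => ⟨_, h₁, h₂.plug (.whyNot .hole)⟩

/-- Weak promotion adds a `?` that must be absorbed in the first stage. `Staged X (.whyNot A)` would
not suffice, as the outer `?` might appear only later; the two alternatives supply a redex of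
`∘`-digging or of digging in time. -/
theorem StagedWhyNot.whyNot {X A : Formula α} :
    StagedWhyNot X A → StagedWhyNot (.whyNot X) A
  | .inl h => .inl <|
      (h.plug (.whyNot .hole)).trans (Redex.digJump.deepDerives (by simp [digRules]))
  | .inr ⟨Y, h₁, h₂⟩ => .inr ⟨Y,
      (h₁.plug (.whyNot .hole)).trans ((Redex.dig Y).deepDerives (by simp [digRules])), h₂⟩

theorem Staged.stagedWhyNot {X A : Formula α} : Staged X A → StagedWhyNot X A :=
  fun ⟨Y, h₁, h₂⟩ => .inr ⟨Y,
    h₁.trans ((Redex.der Y).deepDerives (by simp [digRules])), h₂⟩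

/-- `Unfolds M A`: the formulas in `M` jointly stand for the single formula `A`. -/
inductive Unfolds : Sequent α → Formula α → Prop
  | whyNot (M : Sequent α) (A : Formula α) (hM : M ≠ 0) (h : ∀ X ∈ M, StagedWhyNot X A) :
      Unfolds M (.whyNot A)
  | single (X A : Formula α) (hA : ∀ B, A ≠ .whyNot B) (h : Staged X A) : Unfolds {X} A

theorem unfolds_whyNot_iff {M : Sequent α} {A : Formula α} :
    Unfolds M (.whyNot A) ↔ M ≠ 0 ∧ ∀ X ∈ M, StagedWhyNot X A := by
  refine ⟨fun h => ?_, fun h => .whyNot _ _ h.1 h.2⟩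
  cases h with
  | whyNot _ _ hM h => exact ⟨hM, h⟩
  | single _ _ hA => exact (hA A rfl).elim

/-- The representatives of `?A` are joined by `⅋` one at a time, each `⅋` being paid for by a final
contraction. -/
theorem Unfolds.collapse {M Γ : Sequent α} {A : Formula α} (hM : Unfolds M A)
    (h : LinDerivable (M + Γ)) : ∃ X, Staged X A ∧ LinDerivable (X ::ₘ Γ) := by
  cases hM with
  | single X _ _ hX => exact ⟨X, hX, h⟩
  | whyNot _ A hM hA =>
    obtain ⟨X, hX⟩ := Multiset.exists_mem_of_ne_zero hM
    obtain ⟨M, rfl⟩ := Multiset.exists_cons_of_mem hX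
    replace hX : Staged X (.whyNot A) := (hA X hX).staged
    replace hA : ∀ Y ∈ M, Staged Y (.whyNot A) :=
      fun Y hY => (hA Y (Multiset.mem_cons_of_mem hY)).staged
    clear hM
    induction M using Multiset.induction generalizing X with
    | empty => exact ⟨X, hX, by simpa using h⟩
    | cons Y M ih =>
      refine ih (.par X Y) ?_ (hX.contract (hA Y (Multiset.mem_cons_self _ _)))
        fun Z hZ => hA Z (Multiset.mem_cons_of_mem hZ)
      rw [Multiset.cons_add, Multiset.cons_add] at h
      rw [Multiset.cons_add]
      exact h.par

/-- A formula obtained from `∘` by prefixing `?` can always be added. -/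
theorem LinDerivable.exists_cons_jump {Γ : Sequent α} (h : LinDerivable Γ) :
    ∃ X, DeepDerives digRules X .jump ∧ LinDerivable (X ::ₘ Γ) := by
  induction h with
  | axJ n a =>
    refine ⟨.jump, .refl, ?_⟩
    have := LinDerivable.axJ (n + 1) a
    rwa [Multiset.replicate_succ, Multiset.cons_swap (Formula.neg a), Multiset.cons_swap (Formula.pos a)] at this
  | oneJ n =>
    refine ⟨.jump, .refl, ?_⟩
    have := LinDerivable.oneJ (α := α) (n + 1)
    rwa [Multiset.replicate_succ, Multiset.cons_swap Formula.one] at this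
  | par Γ A B _ ih =>
    obtain ⟨X, hX, h⟩ := ih
    rw [Multiset.cons_swap, Multiset.cons_swap X] at h
    exact ⟨X, hX, by rw [Multiset.cons_swap]; exact h.par⟩
  | tens Γ Δ A B _ hB ih _ =>
    obtain ⟨X, hX, h⟩ := ih
    rw [Multiset.cons_swap] at h
    exact ⟨X, hX, by rw [Multiset.cons_swap, ← Multiset.cons_add]; exact h.tens _ _ _ _ hB⟩
  | weakProm Γ A _ ih =>
    obtain ⟨X, hX, h⟩ := ih
    rw [Multiset.cons_swap] at h
    -- Weak promotion prefixes `?` to the added formula as well; `∘`-digging removes it.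
    refine ⟨.whyNot X, (hX.plug (.whyNot .hole)).trans
      (Redex.digJump.deepDerives (by simp [digRules])), ?_⟩
    rw [Multiset.cons_swap]
    simpa [whyNots] using h.weakProm

theorem Derivable.exists_unfolding {Γ : Sequent α} (h : Derivable Γ) :
    ∃ L : Multiset (Sequent α), Multiset.Rel Unfolds L Γ ∧ LinDerivable L.sum := by
  induction h with
  | ax a =>
    refine ⟨{.pos a} ::ₘ {.neg a} ::ₘ 0, .cons (.single _ _ (by simp) (.refl _))
      (.cons (.single _ _ (by simp) (.refl _)) .zero), ?_⟩
    exact LinDerivable.axJ 0 a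
  | one =>
    refine ⟨{.one} ::ₘ 0, .cons (.single _ _ (by simp) (.refl _)) .zero, ?_⟩
    exact LinDerivable.oneJ 0
  | par Γ A B _ ih =>
    obtain ⟨L, hL, h⟩ := ih
    rw [Multiset.rel_cons_right] at hL
    obtain ⟨M, _, hM, hL, rfl⟩ := hL
    rw [Multiset.rel_cons_right] at hL
    obtain ⟨N, L, hN, hL, rfl⟩ := hL
    rw [Multiset.sum_cons, Multiset.sum_cons] at h
    obtain ⟨X, hX, h⟩ := hM.collapse h
    rw [← Multiset.add_cons] at h
    obtain ⟨Y, hY, h⟩ := hN.collapse h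
    rw [Multiset.cons_swap] at h
    exact ⟨{.par X Y} ::ₘ L, .cons (.single _ _ (by simp) (hX.par hY)) hL,
      by rw [Multiset.sum_cons, Multiset.singleton_add]; exact h.par⟩
  | tens Γ Δ A B _ _ ihA ihB =>
    obtain ⟨L, hL, h⟩ := ihA
    obtain ⟨K, hK, k⟩ := ihB
    rw [Multiset.rel_cons_right] at hL
    obtain ⟨M, L, hM, hL, rfl⟩ := hL
    rw [Multiset.rel_cons_right] at hK
    obtain ⟨N, K, hN, hK, rfl⟩ := hK
    rw [Multiset.sum_cons] at h k
    obtain ⟨X, hX, h⟩ := hM.collapse h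
    obtain ⟨Y, hY, k⟩ := hN.collapse k
    exact ⟨{.tens X Y} ::ₘ (L + K), .cons (.single _ _ (by simp) (hX.tens hY)) (hL.add hK),
      by rw [Multiset.sum_cons, Multiset.singleton_add, Multiset.sum_add]; exact h.tens _ _ _ _ k⟩
  | bot Γ _ ih =>
    obtain ⟨L, hL, h⟩ := ih
    obtain ⟨X, hX, h⟩ := h.exists_cons_jump
    refine ⟨{X} ::ₘ L, .cons (.single _ _ (by simp) ⟨_, hX, _, ?_, .refl⟩) hL, ?_⟩
    · exact Redex.bot.deepDerives (by simp [weakRules])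
    · rwa [Multiset.sum_cons, Multiset.singleton_add]
  | weak Γ A _ ih =>
    obtain ⟨L, hL, h⟩ := ih
    obtain ⟨X, hX, h⟩ := h.exists_cons_jump
    refine ⟨{X} ::ₘ L, .cons (.whyNot _ _ (by simp) ?_) hL, ?_⟩
    · intro Y hY
      rw [Multiset.mem_singleton.1 hY]
      exact .inl hX
    · rwa [Multiset.sum_cons, Multiset.singleton_add]
  | der Γ A _ ih =>
    obtain ⟨L, hL, h⟩ := ih
    rw [Multiset.rel_cons_right] at hL
    obtain ⟨M, L, hM, hL, rfl⟩ := hL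
    rw [Multiset.sum_cons] at h
    obtain ⟨X, hX, h⟩ := hM.collapse h
    refine ⟨{X} ::ₘ L, .cons (.whyNot _ _ (by simp) ?_) hL, ?_⟩
    · simpa using hX.stagedWhyNot
    · rwa [Multiset.sum_cons, Multiset.singleton_add]
  | contr Γ A _ ih =>
    obtain ⟨L, hL, h⟩ := ih
    rw [Multiset.rel_cons_right] at hL
    obtain ⟨M, _, hM, hL, rfl⟩ := hL
    rw [Multiset.rel_cons_right] at hL
    obtain ⟨N, L, hN, hL, rfl⟩ := hL
    rw [unfolds_whyNot_iff] at hM hN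
    -- The linear sequent is unchanged: only its grouping into multisets is coarser.
    refine ⟨(M + N) ::ₘ L, .cons (.whyNot _ _ (by simp [hM.1]) ?_) hL, ?_⟩
    · intro X hX
      exact (Multiset.mem_add.1 hX).elim (hM.2 X) (hN.2 X)
    · rwa [Multiset.sum_cons, add_assoc, ← Multiset.sum_cons, ← Multiset.sum_cons]
  | prom Γ A _ ih =>
    obtain ⟨L, hL, h⟩ := ih
    rw [Multiset.rel_cons_right] at hL
    obtain ⟨M, L, hM, hL, rfl⟩ := hL
    rw [whyNots, Multiset.rel_map_right] at hL
    rw [Multiset.sum_cons] at h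
    obtain ⟨X, hX, h⟩ := hM.collapse h
    refine ⟨{.ofCourse X} ::ₘ L.map whyNots, .cons (.single _ _ (by simp)
      (hX.plug (.ofCourse .hole))) ?_, ?_⟩
    · refine Multiset.rel_map.2 (hL.mono fun M _ B _ hM => ?_)
      rw [unfolds_whyNot_iff] at hM ⊢
      refine ⟨by simpa [whyNots] using hM.1, fun Y hY => ?_⟩
      obtain ⟨Z, hZ, rfl⟩ := Multiset.mem_map.1 hY
      exact (hM.2 Z hZ).whyNot
    -- Prefixing `?` group by group agrees with prefixing it to the whole linear context, so one
    -- weak promotion suffices.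
    · have hsum : (L.map whyNots).sum = whyNots L.sum :=
        (map_multiset_sum (Multiset.mapAddMonoidHom Formula.whyNot) L).symm
      rw [Multiset.sum_cons, Multiset.singleton_add, hsum]
      exact h.weakProm

theorem Provable.exists_staged {F : Formula α} (h : Provable F) :
    ∃ X, LinProvable X ∧ Staged X F := by
  obtain ⟨L, hL, h⟩ := Derivable.exists_unfolding h
  obtain ⟨M, L, hM, hL', rfl⟩ := Multiset.rel_cons_right.1 hL
  obtain rfl := Multiset.rel_zero_right.1 hL'
  rw [Multiset.sum_cons] at h
  obtain ⟨X, hX, h⟩ := hM.collapse h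
  exact ⟨X, h, hX⟩

end MELL

theorem mainTheorem7 {α : Type*} (F : MELL.Formula α) :
    (F.IsMELL →
      (MELL.Provable F ↔
        ∃ F' : MELL.Formula α, MELL.LinProvable F' ∧ MELL.DeepDerives MELL.deepMELL F' F)) ∧
    (MELL.Provable F →
      ∃ F' F'' F''' : MELL.Formula α,
        MELL.LinProvable F' ∧
        MELL.DeepDerives {MELL.DeepRule.der, MELL.DeepRule.dig, MELL.DeepRule.digJump} F' F'' ∧
        MELL.DeepDerives {MELL.DeepRule.weak, MELL.DeepRule.bot} F'' F''' ∧
        MELL.DeepDerives {MELL.DeepRule.contr} F''' F) := by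
  refine ⟨fun hF => ⟨fun h => ?_, fun ⟨F', h', h⟩ =>
    MELL.provable_of_linProvable_of_deepDerives hF h' h⟩, fun h => ?_⟩
  · obtain ⟨X, hX, Y, h₁, Z, h₂, h₃⟩ := h.exists_staged
    refine ⟨X, hX, (h₁.mono ?_).trans ((h₂.mono ?_).trans (h₃.mono ?_))⟩ <;>
      intro ρ hρ <;> cases ρ <;>
      simp_all [MELL.digRules, MELL.weakRules, MELL.deepMELL]
  · obtain ⟨X, hX, Y, h₁, Z, h₂, h₃⟩ := h.exists_staged
    exact ⟨X, Y, Z, hX, h₁, h₂, h₃⟩
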